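/- Let $\alpha=(\alpha_n)_{n\ge 0}$ be a non-negative increasing (i.e. non-decreasing) real sequence with $\lim_{n\to\infty}\alpha_n=\infty$ and $\lim_{n\to\infty}(\alpha_{n+1}-\alpha_n)=l\in[0,\infty)$. Let $\Lambda_\infty(\alpha)$ be the space of all complex sequences $x=(x_n)_{n\ge 0}$ with $|x|_k:=\bigl(\sum_{n}|x_n|^2e^{2k\alpha_n}\bigr)^{1/2}<\infty$ for every $k\in\mathbb N$, with the locally convex topology generated by the norms $|\cdot|_k$, and let $X:=\Lambda_\infty(\alpha)'$ be its strong dual (topology of uniform convergence on bounded subsets of $\Lambda_\infty(\alpha)$). Through $\varphi\mapsto(\varphi(e_n))_n$, with $e_n$ the unit sequences, $X$ is identified with the sequence space $\bigcup_{k}\ell_2(e^{-k\alpha_n})=\{y:\sum_n|y_n|^2e^{-2k\alpha_n}<\infty\text{ for some }k\}$. Let $r,s\in\mathbb R\setminus\{0\}$ and let $B=B(r,s)$ be the continuous operator on $X$ given by $(Bx)_n=s x_{n-1}+r x_n$ for $n\ge0$, with $x_{-1}:=0$. Write $\mathcal L_s(X)$ and $\mathcal L_b(X)$ for the space $\mathcal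 L(X)$ of continuous linear operators on $X$ with the topology of pointwise convergence and of uniform convergence on bounded sets, respectively. An operator $T\in\mathcal L(X)$ is power bounded if $\{T^n:n\ge0\}$ is equicontinuous; it is mean ergodic (resp. uniformly mean ergodic) if the means $T_{[n]}=\frac1n\sum_{m=1}^nT^m$ converge in $\mathcal L_s(X)$ (resp. in $\mathcal L_b(X)$) to an element of $\mathcal L(X)$ as $n\to\infty$; it is supercyclic if there is $x\in X$ such that $\{\lambda T^nx:\lambda\in\mathbb C,\ n\ge0\}$ is dense in $X$. (a) Consider the statements: (1) $B$ is power bounded; (2) $B$ is uniformly mean ergodic; (3) $B$ is mean ergodic; (4) $B^n/n\to0$ in $\mathcal L_s(X)$ as $n\to\infty$; (5) $|r|+|s|\le1$ if $l=0$, and $|r|\le1$ if $l>0$. If $l=0$, then (1)–(5) are equivalent. If $l>0$, then (1)$\Rightarrow$(2)$\Rightarrow$(3)$\Rightarrow$(4)$\Rightarrow$(5). (b) For every $l\in[0,\infty)$: if $|r|+|s|<1$, then $B^n\to0$ in $\mathcal L_b(X)$ as $n\to\infty$. (c) If $l=0$, then $B$ is not supercyclic. -/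

import Mathlib

open Filter Topology

noncomputable section

/-! ### Weighted sequence spaces -/

/-- The weighted space `ℓ₂(v)`: all complex sequences `x` with `∑ |xₙ|² vₙ² < ∞`. -/
def WeightedL2 (v : ℕ → ℝ) : Submodule ℂ (ℕ → ℂ) where
  carrier := {x | Summable fun n => ‖x n‖ ^ 2 * v n ^ 2}
  zero_mem' := by simp
  add_mem' := by
    intro x y hx hy
    refine Summable.of_nonneg_of_le (fun n => by positivity) (fun n => ?_)
      ((hx.add hy).mul_left 2)
    have h1 : ‖x n + y n‖ ^ 2 ≤ 2 * (‖x n‖ ^ 2 + ‖y n‖ ^ 2) := by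
      have h2 := norm_add_le (x n) (y n)
      nlinarith [sq_nonneg (‖x n‖ - ‖y n‖), norm_nonneg (x n + y n), norm_nonneg (x n),
        norm_nonneg (y n)]
    calc ‖(x + y) n‖ ^ 2 * v n ^ 2 ≤ 2 * (‖x n‖ ^ 2 + ‖y n‖ ^ 2) * v n ^ 2 :=
          mul_le_mul_of_nonneg_right h1 (sq_nonneg _)
      _ = 2 * (‖x n‖ ^ 2 * v n ^ 2 + ‖y n‖ ^ 2 * v n ^ 2) := by ring
  smul_mem' := by
    intro c x hx
    refine (hx.mul_left (‖c‖ ^ 2)).congr fun n => ?_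
    simp only [Pi.smul_apply, smul_eq_mul, norm_mul]
    ring

/-- The weights `v_k(n) = exp (k αₙ)`. -/
def expWeight (α : ℕ → ℝ) (k n : ℕ) : ℝ := Real.exp (k * α n)

/-! ### The power series space of infinite type -/

/-- The underlying vector space of `Λ_∞(α)`: the sequences lying in `ℓ₂(v_k)` for all `k`.
The index `k = 0` is redundant, because `α` is nonnegative wherever this is used. -/
def powerSeriesSubmodule (α : ℕ → ℝ) : Submodule ℂ (ℕ → ℂ) :=
  ⨅ k : ℕ, WeightedL2 (expWeight α k)

/-- The power series space `Λ_∞(α)` of infinite type. It is a type of its own, so as not to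
inherit the topology of coordinatewise convergence. -/
def PowerSeriesSpace (α : ℕ → ℝ) : Type := powerSeriesSubmodule α

namespace PowerSeriesSpace

variable {α : ℕ → ℝ}

instance : AddCommGroup (PowerSeriesSpace α) :=
  inferInstanceAs (AddCommGroup (powerSeriesSubmodule α))

instance : Module ℂ (PowerSeriesSpace α) :=
  inferInstanceAs (Module ℂ (powerSeriesSubmodule α))

/-- The sequence underlying an element of `Λ_∞(α)`. -/
def toSeq : PowerSeriesSpace α →ₗ[ℂ] (ℕ → ℂ) := (powerSeriesSubmodule α).subtype

theorem toSeq_injective : Function.Injective (toSeq (α := α)) :=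
  (powerSeriesSubmodule α).injective_subtype

theorem summable (x : PowerSeriesSpace α) (k : ℕ) :
    Summable fun n => ‖toSeq x n‖ ^ 2 * expWeight α k n ^ 2 :=
  (Submodule.mem_iInf _).1 x.2 k

/-- An element of `Λ_∞(α)` from a sequence. -/
def ofSeq (x : ℕ → ℂ) (hx : ∀ k, x ∈ WeightedL2 (expWeight α k)) : PowerSeriesSpace α :=
  ⟨x, (Submodule.mem_iInf _).2 hx⟩

@[simp] theorem toSeq_ofSeq (x : ℕ → ℂ) (hx : ∀ k, x ∈ WeightedL2 (expWeight α k)) :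
    toSeq (ofSeq x hx) = x := rfl

/-- The sequence `(xₙ v_k(n))ₙ` as an element of the unweighted Hilbert space `ℓ₂`. -/
def weightMap (α : ℕ → ℝ) (k : ℕ) : PowerSeriesSpace α →ₗ[ℂ] lp (fun _ : ℕ => ℂ) 2 where
  toFun x := ⟨fun n => toSeq x n * (expWeight α k n : ℂ), by
    refine memℓp_gen ?_
    refine (summable x k).congr fun n => ?_
    simp [mul_pow]⟩
  map_add' x y := by
    ext n
    exact (congrArg (· * (expWeight α k n : ℂ)) (congrFun (map_add toSeq x y) n)).trans
      (add_mul _ _ _)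
  map_smul' c x := by ext n; simp [mul_assoc]

/-- The norms `|x|_k = (∑ |xₙ|² exp (2 k αₙ))^{1/2}`. -/
def seminorms (α : ℕ → ℝ) : SeminormFamily ℂ (PowerSeriesSpace α) ℕ :=
  fun k => (normSeminorm ℂ (lp (fun _ : ℕ => ℂ) 2)).comp (weightMap α k)

theorem seminorms_apply (k : ℕ) (x : PowerSeriesSpace α) :
    seminorms α k x = √(∑' n, ‖toSeq x n‖ ^ 2 * expWeight α k n ^ 2) := by
  have h : seminorms α k x = ‖weightMap α k x‖ := rfl
  rw [h, lp.norm_eq_tsum_rpow (by simp), Real.sqrt_eq_rpow]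
  simp [weightMap, mul_pow]

/-- The locally convex topology of `Λ_∞(α)` generated by the norms `|·|_k`. -/
instance : TopologicalSpace (PowerSeriesSpace α) :=
  (seminorms α).moduleFilterBasis.topology'

theorem withSeminorms (α : ℕ → ℝ) : WithSeminorms (seminorms α) := ⟨rfl⟩

instance : IsTopologicalAddGroup (PowerSeriesSpace α) :=
  (withSeminorms α).topologicalAddGroup

instance : ContinuousSMul ℂ (PowerSeriesSpace α) :=
  (withSeminorms α).continuousSMul

/-- The unit sequences `eₙ`. -/
def unit (α : ℕ → ℝ) (n : ℕ) : PowerSeriesSpace α :=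
  ofSeq (Pi.single n 1) fun k => by
    refine summable_of_ne_finset_zero (s := {n}) fun m hm => ?_
    have : m ≠ n := by simpa using hm
    simp [this]

theorem toSeq_unit (n : ℕ) : toSeq (unit α n) = Pi.single n 1 := rfl

theorem weightMap_unit (k n : ℕ) :
    weightMap α k (unit α n) = lp.single 2 n (expWeight α k n : ℂ) := by
  ext m
  by_cases h : m = n
  · subst h; simp [weightMap, toSeq_unit]
  · simp [weightMap, toSeq_unit, h]

theorem hasSum_unit (x : PowerSeriesSpace α) : HasSum (fun n => toSeq x n • unit α n) x := by
  refine ((withSeminorms α).tendsto_nhds _ _).2 fun k ε hε => ?_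
  have h := lp.hasSum_single (p := 2) (by simp) (weightMap α k x)
  filter_upwards [Metric.tendsto_nhds.1 h ε hε] with t ht
  rw [dist_eq_norm] at ht
  have h1 : seminorms α k (∑ n ∈ t, toSeq x n • unit α n - x) =
      ‖weightMap α k (∑ n ∈ t, toSeq x n • unit α n - x)‖ := rfl
  have h2 : ∀ n, weightMap α k (toSeq x n • unit α n) = lp.single 2 n (weightMap α k x n) := by
    intro n
    rw [map_smul, weightMap_unit, ← lp.single_smul]
    rfl
  rw [h1, map_sub, map_sum]
  simpa only [h2] using ht

/-- The transposed band matrix `x ↦ (r xₙ + s xₙ₊₁)ₙ`, which maps `Λ_∞(α)` into itself because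
`α` is increasing. -/
def transposedLinear (hα : Monotone α) (r s : ℝ) :
    PowerSeriesSpace α →ₗ[ℂ] PowerSeriesSpace α where
  toFun x := ofSeq ((r : ℂ) • toSeq x + (s : ℂ) • fun n => toSeq x (n + 1)) fun k => by
    refine Submodule.add_mem _ (Submodule.smul_mem _ _ (summable x k))
      (Submodule.smul_mem _ _ ?_)
    refine Summable.of_nonneg_of_le (fun n => by positivity) (fun n => ?_)
      ((summable_nat_add_iff 1).2 (summable x k))
    have : expWeight α k n ≤ expWeight α k (n + 1) :=
      Real.exp_le_exp.2 (mul_le_mul_of_nonneg_left (hα n.le_succ) k.cast_nonneg)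
    have h0 : 0 ≤ expWeight α k n := (Real.exp_pos _).le
    gcongr
  map_add' x y := by
    apply toSeq_injective
    funext n
    simp only [toSeq_ofSeq, map_add, Pi.add_apply, Pi.smul_apply, smul_eq_mul]
    ring
  map_smul' c x := by
    apply toSeq_injective
    funext n
    simp only [toSeq_ofSeq, map_smul, Pi.add_apply, Pi.smul_apply, smul_eq_mul, RingHom.id_apply]
    ring

theorem seminorms_transposedLinear_le (hα : Monotone α) (r s : ℝ) (k : ℕ)
    (x : PowerSeriesSpace α) :
    seminorms α k (transposedLinear hα r s x) ≤ (|r| + |s|) * seminorms α k x := by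
  have hw : ∀ n, expWeight α k n ^ 2 ≤ expWeight α k (n + 1) ^ 2 := fun n =>
    pow_le_pow_left₀ (Real.exp_pos _).le
      (Real.exp_le_exp.2 (mul_le_mul_of_nonneg_left (hα n.le_succ) k.cast_nonneg)) 2
  have hsum := (summable_nat_add_iff 1).2 (summable x k)
  have hle : ∀ n, ‖toSeq x (n + 1)‖ ^ 2 * expWeight α k n ^ 2 ≤
      ‖toSeq x (n + 1)‖ ^ 2 * expWeight α k (n + 1) ^ 2 := fun n =>
    mul_le_mul_of_nonneg_left (hw n) (sq_nonneg _)
  have hsum' : Summable fun n => ‖toSeq x (n + 1)‖ ^ 2 * expWeight α k n ^ 2 :=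
    Summable.of_nonneg_of_le (fun n => by positivity) hle hsum
  have hshift : seminorms α k (transposedLinear hα 0 1 x) ≤ seminorms α k x := by
    rw [seminorms_apply, seminorms_apply]
    refine Real.sqrt_le_sqrt ?_
    have h1 : ∀ n, toSeq (transposedLinear hα 0 1 x) n = toSeq x (n + 1) := fun n => by
      simp [transposedLinear]
    simp only [h1]
    refine (hsum'.tsum_le_tsum hle hsum).trans ?_
    rw [(summable x k).tsum_eq_zero_add]
    exact le_add_of_nonneg_left (by positivity)
  have hdec : transposedLinear hα r s x = (r : ℂ) • x + (s : ℂ) • transposedLinear hα 0 1 x := by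
    apply toSeq_injective
    funext n
    simp [transposedLinear]
  calc seminorms α k (transposedLinear hα r s x)
      ≤ seminorms α k ((r : ℂ) • x) + seminorms α k ((s : ℂ) • transposedLinear hα 0 1 x) := by
        rw [hdec]; exact map_add_le_add _ _ _
    _ = |r| * seminorms α k x + |s| * seminorms α k (transposedLinear hα 0 1 x) := by
        simp only [map_smul_eq_mul, Complex.norm_real, Real.norm_eq_abs]
    _ ≤ |r| * seminorms α k x + |s| * seminorms α k x := by gcongr
    _ = (|r| + |s|) * seminorms α k x := by ring

/-- The transposed band matrix as a continuous operator on `Λ_∞(α)`. -/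
def transposed (hα : Monotone α) (r s : ℝ) : PowerSeriesSpace α →L[ℂ] PowerSeriesSpace α where
  toLinearMap := transposedLinear hα r s
  cont := by
    refine (withSeminorms α).continuous_of_isBounded (withSeminorms α)
      (transposedLinear hα r s) ?_
    intro k
    refine ⟨{k}, ⟨|r| + |s|, by positivity⟩, fun x => ?_⟩
    rw [Finset.sup_singleton]
    exact seminorms_transposedLinear_le hα r s k x

end PowerSeriesSpace

/-! ### The strong dual and the generalized difference operator -/

/-- The strong dual `Λ_∞(α)'`, with the topology of uniform convergence on the bounded subsets
of `Λ_∞(α)`. -/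
abbrev PowerSeriesDual (α : ℕ → ℝ) : Type := StrongDual ℂ (PowerSeriesSpace α)

namespace PowerSeriesDual

variable {α : ℕ → ℝ}

/-- The sequence `(φ(eₙ))ₙ`, through which `Λ_∞(α)'` is a space of sequences. -/
def coord : PowerSeriesDual α →ₗ[ℂ] (ℕ → ℂ) where
  toFun φ n := φ (PowerSeriesSpace.unit α n)
  map_add' _ _ := rfl
  map_smul' _ _ := rfl

theorem hasSum_coord (φ : PowerSeriesDual α) (x : PowerSeriesSpace α) :
    HasSum (fun n => PowerSeriesSpace.toSeq x n * coord φ n) (φ x) := by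
  simpa [coord] using (PowerSeriesSpace.hasSum_unit x).mapL φ

theorem coord_injective : Function.Injective (coord (α := α)) := by
  intro φ ψ h
  ext x
  refine (hasSum_coord φ x).unique ?_
  rw [h]
  exact hasSum_coord ψ x

/-- Through its coordinates, `Λ_∞(α)'` is the union of the spaces `ℓ₂(1 / v_k)`. -/
theorem range_coord (hα0 : ∀ n, 0 ≤ α n) :
    Set.range (coord (α := α)) =
      ⋃ k : ℕ, (WeightedL2 fun n => (expWeight α k n)⁻¹ : Set (ℕ → ℂ)) := by
  have hpos : ∀ k n, 0 < expWeight α k n := fun k n => Real.exp_pos _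
  ext y
  simp only [Set.mem_range, Set.mem_iUnion, SetLike.mem_coe]
  constructor
  · rintro ⟨φ, rfl⟩
    obtain ⟨t, C, -, hC⟩ := Seminorm.bound_of_continuous (PowerSeriesSpace.withSeminorms α)
      ((normSeminorm ℂ ℂ).comp φ.toLinearMap) (continuous_norm.comp φ.continuous)
    obtain ⟨k, hk⟩ := t.exists_le
    refine ⟨k, ?_⟩
    have hmono : ∀ x, t.sup (PowerSeriesSpace.seminorms α) x ≤
        PowerSeriesSpace.seminorms α k x := by
      intro x
      refine Seminorm.finset_sup_apply_le (apply_nonneg _ _) fun i hi => ?_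
      rw [PowerSeriesSpace.seminorms_apply, PowerSeriesSpace.seminorms_apply]
      refine Real.sqrt_le_sqrt ((PowerSeriesSpace.summable x i).tsum_le_tsum (fun n => ?_)
        (PowerSeriesSpace.summable x k))
      refine mul_le_mul_of_nonneg_left (pow_le_pow_left₀ (hpos _ _).le ?_ 2) (sq_nonneg _)
      exact Real.exp_le_exp.2 (mul_le_mul_of_nonneg_right (by exact_mod_cast hk i hi) (hα0 n))
    have hb : ∀ x, ‖φ x‖ ≤ C * PowerSeriesSpace.seminorms α k x := fun x =>
      (hC x).trans (mul_le_mul_of_nonneg_left (hmono x) C.coe_nonneg)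
    refine summable_of_sum_le (c := (C : ℝ) ^ 2) (fun n => by positivity) fun u => ?_
    set A := ∑ n ∈ u, ‖coord φ n‖ ^ 2 * (expWeight α k n)⁻¹ ^ 2 with hA
    have hA0 : 0 ≤ A := Finset.sum_nonneg fun n _ => by positivity
    set c : ℕ → ℂ := fun n => (starRingEnd ℂ) (coord φ n) * ((expWeight α k n : ℂ)⁻¹) ^ 2
    set x : PowerSeriesSpace α := ∑ n ∈ u, c n • PowerSeriesSpace.unit α n with hx
    have h1 : φ x = (A : ℂ) := by
      rw [hx, map_sum, hA]
      push_cast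
      refine Finset.sum_congr rfl fun n _ => ?_
      rw [map_smul, smul_eq_mul, ← Complex.conj_mul']
      change c n * coord φ n = _
      simp only [c]
      ring
    have h2 : PowerSeriesSpace.seminorms α k x = √A := by
      have hxs : ∀ n, PowerSeriesSpace.toSeq x n = if n ∈ u then c n else 0 := by
        intro n
        simp [hx, map_sum, PowerSeriesSpace.toSeq_unit, Finset.sum_apply, Pi.single_apply]
      rw [PowerSeriesSpace.seminorms_apply, tsum_eq_sum (s := u), hA]
      · congr 1
        refine Finset.sum_congr rfl fun n hn => ?_
        have := (hpos k n).ne'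
        rw [hxs, if_pos hn]
        simp only [c, norm_mul, norm_pow, norm_inv, Complex.norm_real, Real.norm_eq_abs,
          abs_of_pos (hpos k n), RCLike.norm_conj]
        field_simp
      · intro n hn
        simp [hxs, hn]
    have h3 := hb x
    rw [h1, h2, Complex.norm_real, Real.norm_eq_abs, abs_of_nonneg hA0] at h3
    have h4 := Real.sq_sqrt hA0
    have h5 := Real.sqrt_nonneg A
    have h6 := C.coe_nonneg
    rcases h5.eq_or_lt with h | h
    · nlinarith [sq_nonneg (C : ℝ)]
    · have h7 : √A ≤ C := by
        refine le_of_mul_le_mul_right ?_ h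
        nlinarith
      nlinarith
  · rintro ⟨k, hk⟩
    let z : lp (fun _ : ℕ => ℂ) 2 := ⟨fun n => (starRingEnd ℂ) (y n) * (expWeight α k n : ℂ)⁻¹, by
      refine memℓp_gen (hk.congr fun n => ?_)
      simp [mul_pow]⟩
    have hcont : Continuous (PowerSeriesSpace.weightMap α k) :=
      (PowerSeriesSpace.withSeminorms α).continuous_normedSpace_rng _ _
        ⟨{k}, 1, fun x => by simp [PowerSeriesSpace.seminorms]⟩
    refine ⟨(innerSL ℂ z).comp ⟨PowerSeriesSpace.weightMap α k, hcont⟩, ?_⟩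
    funext n
    have : (expWeight α k n : ℂ) ≠ 0 := by exact_mod_cast (hpos k n).ne'
    change inner ℂ z (PowerSeriesSpace.weightMap α k (PowerSeriesSpace.unit α n)) = y n
    rw [PowerSeriesSpace.weightMap_unit, lp.inner_single_right]
    simp [z]
    field_simp

end PowerSeriesDual

/-- The matrix `B(r, s)` acting on all complex sequences: `(B x)ₙ = s xₙ₋₁ + r xₙ`, `x₋₁ = 0`. -/
def bandMatrix (r s : ℝ) : (ℕ → ℂ) →ₗ[ℂ] (ℕ → ℂ) where
  toFun x n := (if n = 0 then 0 else s * x (n - 1)) + r * x n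
  map_add' x y := by
    funext n
    by_cases hn : n = 0 <;> simp [hn] <;> ring
  map_smul' c x := by
    funext n
    by_cases hn : n = 0 <;> simp [hn] <;> ring

/-- The operator `B(r, s)` on `Λ_∞(α)'`, given as the dual operator of the transposed matrix on
`Λ_∞(α)`. By `coord_diffOp` and `PowerSeriesDual.coord_injective` it is the unique operator that
acts on the coordinate sequences as the matrix `B(r, s)`. -/
def diffOp {α : ℕ → ℝ} (hα : Monotone α) (r s : ℝ) : PowerSeriesDual α →L[ℂ] PowerSeriesDual α :=
  ContinuousLinearMap.precomp ℂ (PowerSeriesSpace.transposed hα r s)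

theorem coord_diffOp {α : ℕ → ℝ} (hα : Monotone α) (r s : ℝ) (φ : PowerSeriesDual α) :
    PowerSeriesDual.coord (diffOp hα r s φ) = bandMatrix r s (PowerSeriesDual.coord φ) := by
  funext n
  have h : PowerSeriesSpace.transposed hα r s (PowerSeriesSpace.unit α n) =
      (r : ℂ) • PowerSeriesSpace.unit α n +
        (if n = 0 then 0 else (s : ℂ) • PowerSeriesSpace.unit α (n - 1)) := by
    apply PowerSeriesSpace.toSeq_injective
    funext m
    rcases n with _ | n
    · simp [PowerSeriesSpace.transposed, PowerSeriesSpace.transposedLinear,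
        PowerSeriesSpace.toSeq_unit]
    · by_cases hm : m = n <;>
        simp [PowerSeriesSpace.transposed, PowerSeriesSpace.transposedLinear,
          PowerSeriesSpace.toSeq_unit, hm, Pi.single_apply]
  change φ (PowerSeriesSpace.transposed hα r s (PowerSeriesSpace.unit α n)) = _
  rw [h]
  rcases n with _ | n <;> simp [bandMatrix, PowerSeriesDual.coord, add_comm]

/-! ### Dynamics of operators on topological vector spaces -/

section Dynamics

variable {X : Type*} [AddCommGroup X] [Module ℂ X] [UniformSpace X] [IsUniformAddGroup X]
  [ContinuousConstSMul ℂ X]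

/-- `T` is power bounded: its powers form an equicontinuous set. -/
def IsPowerBounded (T : X →L[ℂ] X) : Prop :=
  Equicontinuous fun n : ℕ => ((T ^ n : X →L[ℂ] X) : X → X)

/-- The Cesàro means `T_[n] = (1/n) ∑_{m=1}^n T^m`, for `n ≥ 1`. -/
def cesaroMean (T : X →L[ℂ] X) (n : ℕ) : X →L[ℂ] X :=
  (n : ℂ)⁻¹ • ∑ m ∈ Finset.Icc 1 n, T ^ m

/-- Convergence of a sequence of operators in `L_s(X)`, the topology of pointwise convergence. -/
def TendstoStrongly (u : ℕ → X →L[ℂ] X) (P : X →L[ℂ] X) : Prop :=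
  ∀ x, Tendsto (fun n => u n x) atTop (𝓝 (P x))

/-- Convergence of a sequence of operators in `L_b(X)`, the topology of uniform convergence on
bounded sets, which is the topology that Mathlib puts on `X →L[ℂ] X`. -/
def TendstoBounded (u : ℕ → X →L[ℂ] X) (P : X →L[ℂ] X) : Prop :=
  Tendsto u atTop (𝓝 P)

/-- `T` is mean ergodic: its Cesàro means converge in `L_s(X)`. -/
def IsMeanErgodic (T : X →L[ℂ] X) : Prop :=
  ∃ P : X →L[ℂ] X, TendstoStrongly (cesaroMean T) P

/-- `T` is uniformly mean ergodic: its Cesàro means converge in `L_b(X)`. -/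
def IsUniformlyMeanErgodic (T : X →L[ℂ] X) : Prop :=
  ∃ P : X →L[ℂ] X, TendstoBounded (cesaroMean T) P

/-- `T` is supercyclic: some projective orbit `{lam • T^n x}` is dense. -/
def IsSupercyclic (T : X →L[ℂ] X) : Prop :=
  ∃ x : X, Dense {y : X | ∃ (lam : ℂ) (n : ℕ), y = lam • (T ^ n) x}

end Dynamics

end

/-! Write `A` for the transposed matrix on `Λ_∞(α)`, so that `(B^n φ)(x) = φ(A^n x)`; every
statement about `B` is read off `A`.

Upper bounds: the weights increase with `n`, so the backward shift contracts each norm and `|A^n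
x|_k ≤ (|r| + |s|)^n |x|_k`. This gives power boundedness when `|r| + |s| ≤ 1` and convergence to
zero when `|r| + |s| < 1`.

Lower bounds: an eigenvector `A x = μ x` gives `(B^n φ)(x) = μ^n φ(x)`, so `B^n / n → 0` forces `|μ|
≤ 1`. Always `A e₀ = r e₀`. If `l = 0`, the sequences `(q^n)` with `0 < |q| < 1` lie in `Λ_∞(α)` and
have eigenvalue `r + s q`; real `q` of the right sign with `|q| → 1` gives `|r| + |s| ≤ 1`. Two such
eigenvectors also exclude supercyclicity, since evaluating at both bounds a ratio along the whole
projective orbit.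

The main step is from power bounded to uniformly mean ergodic. Power boundedness passes from `B` to
`A` by Hahn–Banach and metrizability (`exists_bound_of_isPowerBounded`). The means of `A` telescope
to zero on the range of `I - A`, which contains every unit sequence because `s ≠ 0`. Since `αₙ → ∞`,
tails of unit expansions are uniformly small on bounded sets, so the means of `A` tend to zero
uniformly there; `tendstoBounded_zero` dualizes this. -/

noncomputable section

/-! ### Norms, bounded sets and the transposed matrix on `Λ_∞(α)` -/

namespace PowerSeriesSpace

variable {α : ℕ → ℝ}

theorem expWeight_pos (α : ℕ → ℝ) (k n : ℕ) : 0 < expWeight α k n := Real.exp_pos _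

theorem norm_toSeq_mul_le (k n : ℕ) (x : PowerSeriesSpace α) :
    ‖toSeq x n‖ * expWeight α k n ≤ seminorms α k x := by
  have h := lp.norm_apply_le_norm (by simp) (weightMap α k x) n
  have h1 : ‖weightMap α k x n‖ = ‖toSeq x n‖ * expWeight α k n := by
    change ‖toSeq x n * (expWeight α k n : ℂ)‖ = _
    rw [norm_mul, Complex.norm_real, Real.norm_eq_abs, abs_of_pos (expWeight_pos α k n)]
  rwa [h1] at h

theorem eq_zero_of_seminorms_eq_zero {k : ℕ} {x : PowerSeriesSpace α}
    (h : seminorms α k x = 0) : x = 0 := by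
  apply toSeq_injective
  funext n
  have h1 := norm_toSeq_mul_le k n x
  rw [h] at h1
  simpa using nonpos_of_mul_nonpos_left h1 (expWeight_pos α k n)

theorem seminorms_mono (hα0 : ∀ n, 0 ≤ α n) : Monotone (seminorms α) := by
  intro i k hik x
  rw [seminorms_apply, seminorms_apply]
  refine Real.sqrt_le_sqrt ((summable x i).tsum_le_tsum (fun n => ?_) (summable x k))
  refine mul_le_mul_of_nonneg_left (pow_le_pow_left₀ (expWeight_pos α i n).le ?_ 2) (sq_nonneg _)
  exact Real.exp_le_exp.2 (mul_le_mul_of_nonneg_right (by exact_mod_cast hik) (hα0 n))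

theorem isVonNBounded_iff {S : Set (PowerSeriesSpace α)} :
    Bornology.IsVonNBounded ℂ S ↔ ∀ k, ∃ M, ∀ x ∈ S, seminorms α k x ≤ M := by
  rw [(withSeminorms α).isVonNBounded_iff_seminorm_bddAbove]
  simp [bddAbove_def]

/-- A family of seminorms that is uniformly bounded on each bounded set is equicontinuous,
because `Λ_∞(α)` is metrizable. -/
theorem exists_bound_of_bounded (hα0 : ∀ n, 0 ≤ α n) {ι : Type*}
    (Q : ι → Seminorm ℂ (PowerSeriesSpace α))
    (hQ : ∀ S : Set (PowerSeriesSpace α), Bornology.IsVonNBounded ℂ S →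
      ∃ M : ℝ, ∀ i, ∀ x ∈ S, Q i x ≤ M) :
    ∃ (k : ℕ) (C : ℝ), 0 ≤ C ∧ ∀ i x, Q i x ≤ C * seminorms α k x := by
  by_contra! h
  -- Failure is used along the diagonal: norm index `k` together with constant `k`.
  choose i x hx using fun k : ℕ => h k k k.cast_nonneg
  have hpos : ∀ k, 0 < seminorms α k (x k) := by
    intro k
    refine (apply_nonneg _ _).lt_of_ne fun h0 => ?_
    have h1 := hx k
    rw [eq_zero_of_seminorms_eq_zero h0.symm] at h1
    simp at h1
  set y : ℕ → PowerSeriesSpace α := fun k => ((seminorms α k (x k))⁻¹ : ℂ) • x k with hy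
  have hnorm : ∀ k, ‖((seminorms α k (x k))⁻¹ : ℂ)‖ = (seminorms α k (x k))⁻¹ := fun k => by
    rw [norm_inv, Complex.norm_real, Real.norm_eq_abs, abs_of_pos (hpos k)]
  have hy1 : ∀ k, seminorms α k (y k) = 1 := fun k => by
    rw [hy, map_smul_eq_mul, hnorm, inv_mul_cancel₀ (hpos k).ne']
  have hQy : ∀ k : ℕ, (k : ℝ) < Q (i k) (y k) := fun k => by
    rw [hy, map_smul_eq_mul, hnorm, inv_mul_eq_div, lt_div_iff₀ (hpos k)]
    exact hx k
  have hb : Bornology.IsVonNBounded ℂ (Set.range y) := by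
    rw [isVonNBounded_iff]
    intro j
    -- For `k ≥ j` monotonicity of the norms gives `|y_k|_j ≤ |y_k|_k = 1`; the sum absorbs the
    -- finitely many `k < j`.
    refine ⟨1 + ∑ m ∈ Finset.range j, seminorms α j (y m), ?_⟩
    rintro _ ⟨k, rfl⟩
    have h0 : 0 ≤ ∑ m ∈ Finset.range j, seminorms α j (y m) :=
      Finset.sum_nonneg fun _ _ => apply_nonneg _ _
    rcases le_or_gt j k with hjk | hjk
    · have := seminorms_mono hα0 hjk (y k)
      rw [hy1] at this
      linarith
    · have := Finset.single_le_sum (f := fun m => seminorms α j (y m))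
        (fun _ _ => apply_nonneg _ _) (Finset.mem_range.2 hjk)
      linarith
  obtain ⟨M, hM⟩ := hQ _ hb
  obtain ⟨k, hk⟩ := exists_nat_gt M
  linarith [hM (i k) (y k) ⟨k, rfl⟩, hQy k]

/-- The tail of the expansion in unit sequences is small uniformly on bounded sets. -/
theorem seminorms_sub_sum_le (hα : Monotone α) (k N : ℕ) (x : PowerSeriesSpace α) :
    seminorms α k (x - ∑ m ∈ Finset.range N, toSeq x m • unit α m) ≤
      Real.exp (-α N) * seminorms α (k + 1) x := by
  set y := x - ∑ m ∈ Finset.range N, toSeq x m • unit α m with hy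
  have hyn : ∀ n, toSeq y n = if n < N then 0 else toSeq x n := by
    intro n
    have : toSeq (∑ m ∈ Finset.range N, toSeq x m • unit α m) n =
        if n < N then toSeq x n else 0 := by
      simp [map_sum, toSeq_unit, Finset.sum_apply, Pi.single_apply]
    rw [hy, map_sub, Pi.sub_apply, this]
    split_ifs <;> simp
  rw [seminorms_apply, seminorms_apply, ← Real.sqrt_sq (Real.exp_pos (-α N)).le,
    ← Real.sqrt_mul (sq_nonneg _), ← tsum_mul_left]
  refine Real.sqrt_le_sqrt ((summable y k).tsum_le_tsum (fun n => ?_)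
    ((summable x (k + 1)).mul_left _))
  rw [hyn]
  split_ifs with hn
  · simp only [norm_zero, zero_pow two_ne_zero, zero_mul]; positivity
  -- Raising the norm index by one gains a factor `exp (αₙ) ≥ exp (α_N)` on the tail `n ≥ N`.
  · have h1 : expWeight α k n ≤ Real.exp (-α N) * expWeight α (k + 1) n := by
      rw [expWeight, expWeight, ← Real.exp_add]
      refine Real.exp_le_exp.2 ?_
      push_cast
      linarith [hα (not_lt.1 hn)]
    have h2 := pow_le_pow_left₀ (expWeight_pos α k n).le h1 2
    nlinarith [sq_nonneg ‖toSeq x n‖]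

theorem transposed_unit_zero (hα : Monotone α) (r s : ℝ) :
    transposed hα r s (unit α 0) = (r : ℂ) • unit α 0 := by
  apply toSeq_injective
  funext m
  simp [transposed, transposedLinear, toSeq_unit]

theorem transposed_unit_succ (hα : Monotone α) (r s : ℝ) (n : ℕ) :
    transposed hα r s (unit α (n + 1)) = (r : ℂ) • unit α (n + 1) + (s : ℂ) • unit α n := by
  apply toSeq_injective
  funext m
  by_cases hm : m = n <;>
    simp [transposed, transposedLinear, toSeq_unit, hm, Pi.single_apply]

/-- Each application costs at most `|r| + |s|` in the same norm, so iterating loses no norm index.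
-/
theorem seminorms_transposed_pow_le (hα : Monotone α) (r s : ℝ) (k n : ℕ)
    (x : PowerSeriesSpace α) :
    seminorms α k ((transposed hα r s ^ n) x) ≤ (|r| + |s|) ^ n * seminorms α k x := by
  induction n with
  | zero => simp
  | succ n ih =>
    rw [pow_succ', mul_apply_eq_comp]
    refine (seminorms_transposedLinear_le hα r s k _).trans ?_
    rw [pow_succ', mul_assoc]
    gcongr

/-- If `αₙ₊₁ - αₙ → 0`, then `Λ_∞(α)` contains the geometric sequences. -/
theorem geometric_mem (hα_diff : Tendsto (fun n => α (n + 1) - α n) atTop (𝓝 0)) {q : ℂ}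
    (hq0 : q ≠ 0) (hq : ‖q‖ < 1) (k : ℕ) :
    (fun n => q ^ n) ∈ WeightedL2 (expWeight α k) := by
  change Summable fun n => ‖q ^ n‖ ^ 2 * expWeight α k n ^ 2
  have hne : ∀ n, 0 < ‖q ^ n‖ ^ 2 * expWeight α k n ^ 2 := fun n => by
    have := expWeight_pos α k n
    have := norm_pos_iff.2 (pow_ne_zero n hq0)
    positivity
  -- The weight contributes `exp (k (αₙ₊₁ - αₙ))² → 1` to the ratio, so the limit does not depend on
  -- `k`.
  refine summable_of_ratio_test_tendsto_lt_one (l := ‖q‖ ^ 2) ?_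
    (Eventually.of_forall fun n => (hne n).ne') ?_
  · nlinarith [norm_nonneg q]
  · have h1 : Tendsto (fun n => ‖q‖ ^ 2 * Real.exp (k * (α (n + 1) - α n)) ^ 2) atTop
        (𝓝 (‖q‖ ^ 2 * Real.exp (k * 0) ^ 2)) :=
      (((Real.continuous_exp.tendsto _).comp (hα_diff.const_mul _)).pow 2).const_mul _
    simp only [mul_zero, Real.exp_zero, one_pow, mul_one] at h1
    refine h1.congr fun n => ?_
    rw [Real.norm_of_nonneg (hne _).le, Real.norm_of_nonneg (hne _).le, eq_div_iff (hne n).ne']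
    have : expWeight α k (n + 1) = Real.exp (k * (α (n + 1) - α n)) * expWeight α k n := by
      rw [expWeight, expWeight, ← Real.exp_add]
      ring_nf
    rw [this]
    simp only [norm_pow]
    ring

theorem transposed_geometric (hα : Monotone α) (r s : ℝ) (q : ℂ)
    (hq : ∀ k, (fun n => q ^ n) ∈ WeightedL2 (expWeight α k)) :
    transposed hα r s (ofSeq (fun n => q ^ n) hq) =
      ((r : ℂ) + s * q) • ofSeq (fun n => q ^ n) hq := by
  apply toSeq_injective
  funext m
  simp [transposed, transposedLinear]
  ring

/-- The Cesàro means of the transposed matrix. -/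
def transposedMean (hα : Monotone α) (r s : ℝ) (n : ℕ) :
    PowerSeriesSpace α →L[ℂ] PowerSeriesSpace α :=
  (n : ℂ)⁻¹ • ∑ m ∈ Finset.Icc 1 n, transposed hα r s ^ m

end PowerSeriesSpace

/-! ### Power boundedness and Cesàro means of a general operator -/

section Dynamics

theorem ContinuousLinearMap.pow_succ_apply {X : Type*} [AddCommGroup X] [Module ℂ X]
    [TopologicalSpace X] (T : X →L[ℂ] X) (n : ℕ) (x : X) : (T ^ (n + 1)) x = T ((T ^ n) x) := by
  rw [pow_succ', mul_apply_eq_comp]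

theorem ContinuousLinearMap.pow_succ_apply' {X : Type*} [AddCommGroup X] [Module ℂ X]
    [TopologicalSpace X] (T : X →L[ℂ] X) (n : ℕ) (x : X) : (T ^ (n + 1)) x = (T ^ n) (T x) := by
  rw [pow_succ, mul_apply_eq_comp]

theorem isPowerBounded_iff {X : Type*} [AddCommGroup X] [Module ℂ X] [UniformSpace X]
    [IsUniformAddGroup X] {T : X →L[ℂ] X} :
    IsPowerBounded T ↔ ∀ V ∈ 𝓝 (0 : X), ∀ᶠ x in 𝓝 (0 : X), ∀ n : ℕ, (T ^ n) x ∈ V := by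
  constructor
  · intro h V hV
    have hU : {p : X × X | p.2 - p.1 ∈ V} ∈ uniformity X := by
      rw [uniformity_eq_comap_nhds_zero]
      exact preimage_mem_comap hV
    filter_upwards [h 0 _ hU] with x hx n
    simpa using hx n
  · intro h
    refine equicontinuous_of_equicontinuousAt_zero (fun n : ℕ => (T ^ n : X →L[ℂ] X)) ?_
    intro U hU
    rw [uniformity_eq_comap_nhds_zero] at hU
    obtain ⟨V, hV, hVU⟩ := hU
    filter_upwards [h V hV] with x hx n
    exact hVU (by simpa using hx n)

variable {X : Type*} [AddCommGroup X] [Module ℂ X] [UniformSpace X] [IsUniformAddGroup X]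

theorem cesaroMean_apply [ContinuousConstSMul ℂ X] (T : X →L[ℂ] X) (n : ℕ) (x : X) :
    cesaroMean T n x = (n : ℂ)⁻¹ • ∑ m ∈ Finset.Icc 1 n, (T ^ m) x := by
  rw [cesaroMean, smul_apply, sum_apply]

theorem IsUniformlyMeanErgodic.isMeanErgodic [ContinuousSMul ℂ X] {T : X →L[ℂ] X}
    (h : IsUniformlyMeanErgodic T) : IsMeanErgodic T := by
  obtain ⟨P, hP⟩ := h
  exact ⟨P, fun x => ((continuous_eval_const x).tendsto P).comp hP⟩

/-- Rests on `T^(n+1) / (n+1) = T_[n+1] - (n / (n+1)) T_[n]`, where both terms on the right have the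
same limit. -/
theorem IsMeanErgodic.tendstoStrongly_inv_smul_pow [ContinuousSMul ℂ X] {T : X →L[ℂ] X}
    (h : IsMeanErgodic T) : TendstoStrongly (fun n : ℕ => (n : ℂ)⁻¹ • T ^ n) 0 := by
  obtain ⟨P, hP⟩ := h
  intro x
  have h1 : Tendsto (fun n : ℕ => ((n : ℂ) / (n + 1)) • cesaroMean T n x) atTop
      (𝓝 ((1 : ℂ) • P x)) := (tendsto_natCast_div_add_atTop (1 : ℂ)).smul (hP x)
  have h2 := ((tendsto_add_atTop_iff_nat 1).2 (hP x)).sub h1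
  rw [one_smul, sub_self] at h2
  refine (tendsto_add_atTop_iff_nat 1).1 (h2.congr fun n => ?_)
  have hn : ((n : ℂ) + 1) ≠ 0 := by exact_mod_cast n.succ_ne_zero
  rw [cesaroMean_apply, cesaroMean_apply, Finset.sum_Icc_succ_top (by omega), smul_smul,
    smul_apply, smul_add]
  -- The cancellation `n * n⁻¹ = 1` fails at `n = 0`, where the sum is empty anyway.
  rcases eq_or_ne n 0 with rfl | hn0
  · simp
  · have : ((n : ℂ) / (n + 1)) * (n : ℂ)⁻¹ = ((n + 1 : ℕ) : ℂ)⁻¹ := by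
      have : (n : ℂ) ≠ 0 := by exact_mod_cast hn0
      push_cast
      field_simp
    rw [this]
    abel

end Dynamics

/-! ### Transfer between `A` on `Λ_∞(α)` and `B` on the strong dual -/

namespace PowerSeriesDual

open PowerSeriesSpace

variable {α : ℕ → ℝ}

theorem diffOp_pow_apply (hα : Monotone α) (r s : ℝ) (n : ℕ) (φ : PowerSeriesDual α)
    (x : PowerSeriesSpace α) : (diffOp hα r s ^ n) φ x = φ ((transposed hα r s ^ n) x) := by
  induction n generalizing x with
  | zero => rfl
  | succ n ih =>
    refine (DFunLike.congr_fun
      (ContinuousLinearMap.pow_succ_apply (diffOp hα r s) n φ) x).trans ?_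
    rw [ContinuousLinearMap.pow_succ_apply']
    exact ih _

theorem cesaroMean_diffOp_apply (hα : Monotone α) (r s : ℝ) (n : ℕ) (φ : PowerSeriesDual α)
    (x : PowerSeriesSpace α) :
    cesaroMean (diffOp hα r s) n φ x = φ (transposedMean hα r s n x) := by
  rw [cesaroMean_apply, transposedMean, smul_apply,
    smul_apply, map_smul, sum_apply, sum_apply, map_sum]
  simp only [diffOp_pow_apply]

theorem hasBasis_nhds_zero : (𝓝 (0 : PowerSeriesDual α)).HasBasis
    (fun p : Set (PowerSeriesSpace α) × ℝ => Bornology.IsVonNBounded ℂ p.1 ∧ 0 < p.2)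
    (fun p => {φ | ∀ x ∈ p.1, φ x ∈ Metric.ball 0 p.2}) :=
  ContinuousLinearMap.hasBasis_nhds_zero_of_basis Metric.nhds_basis_ball

/-- Strongly bounded sets of functionals are equicontinuous. -/
theorem exists_bound_of_isVonNBounded (hα0 : ∀ n, 0 ≤ α n) {C : Set (PowerSeriesDual α)}
    (hC : Bornology.IsVonNBounded ℂ C) :
    ∃ (k : ℕ) (K : ℝ), 0 ≤ K ∧ ∀ φ ∈ C, ∀ x, ‖φ x‖ ≤ K * seminorms α k x := by
  obtain ⟨k, K, hK, h⟩ := exists_bound_of_bounded hα0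
    (fun φ : C => (normSeminorm ℂ ℂ).comp (φ : PowerSeriesDual α).toLinearMap) fun S hS => by
      have h1 := ContinuousLinearMap.isVonNBounded_image2_apply hC hS
      obtain ⟨M, hM⟩ := (NormedSpace.isVonNBounded_iff' ℂ).1 h1
      exact ⟨M, fun φ x hx => hM _ ⟨φ, φ.2, x, hx, rfl⟩⟩
  exact ⟨k, K, hK, fun φ hφ x => h ⟨φ, hφ⟩ x⟩

/-- Dual operators converge to zero uniformly on bounded sets when the original maps do. -/
theorem tendstoBounded_zero (hα0 : ∀ n, 0 ≤ α n) {D : ℕ → PowerSeriesDual α →L[ℂ] PowerSeriesDual α}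
    {a : ℕ → PowerSeriesSpace α → PowerSeriesSpace α} (hD : ∀ n φ x, D n φ x = φ (a n x))
    (ha : ∀ S, Bornology.IsVonNBounded ℂ S → ∀ k, ∀ ε > 0, ∀ᶠ n in atTop, ∀ x ∈ S,
      seminorms α k (a n x) < ε) :
    TendstoBounded D 0 := by
  refine (ContinuousLinearMap.hasBasis_nhds_zero_of_basis hasBasis_nhds_zero).tendsto_right_iff.2 ?_
  rintro ⟨C, S, ε⟩ ⟨hC, hS, hε⟩
  obtain ⟨k, K, hK, h⟩ := exists_bound_of_isVonNBounded hα0 hC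
  -- `K + 1` rather than `K`, because `K` may vanish.
  filter_upwards [ha S hS k (ε / (K + 1)) (by simp only at hε; positivity)] with n hn φ hφ x hx
  rw [mem_ball_zero_iff, hD]
  have h1 := hn x hx
  rw [lt_div_iff₀ (by positivity)] at h1
  have h2 := h φ hφ (a n x)
  have h3 : 0 ≤ seminorms α k (a n x) := apply_nonneg _ _
  nlinarith

theorem isPowerBounded_diffOp (hα : Monotone α) {r s : ℝ} (h : |r| + |s| ≤ 1) :
    IsPowerBounded (diffOp hα r s) := by
  refine isPowerBounded_iff.2 fun V hV => ?_
  obtain ⟨⟨S, ε⟩, ⟨hS, hε⟩, hV⟩ := hasBasis_nhds_zero.mem_iff.1 hV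
  -- The union of all images of `S` stays bounded, so its polar neighbourhood serves every `n` at
  -- once.
  set S' : Set (PowerSeriesSpace α) := ⋃ n : ℕ, (transposed hα r s ^ n) '' S with hS'
  have hS'b : Bornology.IsVonNBounded ℂ S' := by
    rw [PowerSeriesSpace.isVonNBounded_iff] at hS ⊢
    intro k
    obtain ⟨M, hM⟩ := hS k
    refine ⟨M, fun y hy => ?_⟩
    obtain ⟨n, x, hx, rfl⟩ := Set.mem_iUnion.1 hy
    refine (seminorms_transposed_pow_le hα r s k n x).trans (le_trans ?_ (hM x hx))
    exact mul_le_of_le_one_left (apply_nonneg _ _) (pow_le_one₀ (by positivity) h)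
  filter_upwards [hasBasis_nhds_zero.mem_of_mem (i := (S', ε)) ⟨hS'b, hε⟩] with φ hφ n
  refine hV fun x hx => ?_
  rw [diffOp_pow_apply]
  exact hφ _ (Set.mem_iUnion.2 ⟨n, x, hx, rfl⟩)

/-- If the dual operator is power bounded, then so is the original operator. -/
theorem exists_bound_of_isPowerBounded (hα0 : ∀ n, 0 ≤ α n) (hα : Monotone α) {r s : ℝ}
    (h : IsPowerBounded (diffOp hα r s)) (k : ℕ) :
    ∃ (j : ℕ) (C : ℝ), 0 ≤ C ∧ ∀ (n : ℕ) (x : PowerSeriesSpace α),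
      seminorms α k ((transposed hα r s ^ n) x) ≤ C * seminorms α j x := by
  refine exists_bound_of_bounded hα0
    (fun n : ℕ => (seminorms α k).comp (transposed hα r s ^ n).toLinearMap) fun S hS => ?_
  have hV := hasBasis_nhds_zero.mem_of_mem (i := (S, 1)) ⟨hS, one_pos⟩
  obtain ⟨⟨S', ε⟩, ⟨hS', hε⟩, hsub⟩ := hasBasis_nhds_zero.mem_iff.1 (isPowerBounded_iff.1 h _ hV)
  simp only at hε hsub
  obtain ⟨M, hM⟩ := PowerSeriesSpace.isVonNBounded_iff.1 hS' k
  have hcont : Continuous (weightMap α k) :=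
    (withSeminorms α).continuous_normedSpace_rng _ _ ⟨{k}, 1, fun x => by simp [seminorms]⟩
  let W : PowerSeriesSpace α →L[ℂ] lp (fun _ : ℕ => ℂ) 2 := ⟨weightMap α k, hcont⟩
  have hM0 : 0 < |M| + 1 := by positivity
  refine ⟨2 * (|M| + 1) / ε, fun n x hx => ?_⟩
  -- Hahn–Banach: `g` norms the image of `A^n x` in `ℓ₂`. The factor `c` puts `c • g ∘ W` in the
  -- neighbourhood given by `S'` and `ε`, and the resulting bound on `|A^n x|_k` is independent of
  -- `n`.
  obtain ⟨g, hg1, hg2⟩ := exists_dual_vector'' ℂ (W ((transposed hα r s ^ n) x))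
  set c : ℂ := ((ε / (2 * (|M| + 1)) : ℝ) : ℂ) with hc
  have hcn : ‖c‖ = ε / (2 * (|M| + 1)) := by
    rw [hc, Complex.norm_real, Real.norm_of_nonneg (by positivity)]
  have hmem : c • g.comp W ∈ {φ : PowerSeriesDual α | ∀ y ∈ S', φ y ∈ Metric.ball 0 ε} := by
    intro y hy
    rw [mem_ball_zero_iff]
    have h1 : ‖g (W y)‖ ≤ |M| := by
      have h2 : ‖W y‖ ≤ M := hM y hy
      calc ‖g (W y)‖ ≤ ‖g‖ * ‖W y‖ := g.le_opNorm _
        _ ≤ 1 * |M| := mul_le_mul hg1 (h2.trans (le_abs_self _)) (norm_nonneg _) zero_le_one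
        _ = |M| := one_mul _
    change ‖c * g (W y)‖ < ε
    rw [norm_mul, hcn, div_mul_eq_mul_div, div_lt_iff₀ (by positivity)]
    nlinarith [abs_nonneg M]
  have h3 := hsub hmem n x hx
  rw [mem_ball_zero_iff, diffOp_pow_apply] at h3
  change ‖c * g (W ((transposed hα r s ^ n) x))‖ < 1 at h3
  rw [norm_mul, hcn, hg2, RCLike.norm_ofReal, abs_norm, div_mul_eq_mul_div,
    div_lt_iff₀ (by positivity), one_mul] at h3
  change ‖W ((transposed hα r s ^ n) x)‖ ≤ _
  rw [le_div_iff₀ hε]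
  linarith

theorem tendstoBounded_diffOp_pow (hα0 : ∀ n, 0 ≤ α n) (hα : Monotone α) {r s : ℝ}
    (h : |r| + |s| < 1) : TendstoBounded (fun n : ℕ => diffOp hα r s ^ n) 0 := by
  refine tendstoBounded_zero hα0 (diffOp_pow_apply hα r s) fun S hS k ε hε => ?_
  obtain ⟨M, hM⟩ := PowerSeriesSpace.isVonNBounded_iff.1 hS k
  have h1 := (tendsto_pow_atTop_nhds_zero_of_lt_one (r := |r| + |s|) (by positivity) h).mul_const M
  rw [zero_mul] at h1
  filter_upwards [h1.eventually_lt_const hε] with n hn x hx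
  refine lt_of_le_of_lt ((seminorms_transposed_pow_le hα r s k n x).trans ?_) hn
  exact mul_le_mul_of_nonneg_left (hM x hx) (by positivity)

end PowerSeriesDual

/-! ### Cesàro means of the transposed matrix -/

namespace PowerSeriesSpace

variable {α : ℕ → ℝ}

theorem transposedMean_sub (hα : Monotone α) (r s : ℝ) (n : ℕ) (w : PowerSeriesSpace α) :
    transposedMean hα r s n (w - transposed hα r s w) =
      (n : ℂ)⁻¹ • (transposed hα r s w - (transposed hα r s ^ (n + 1)) w) := by
  rw [transposedMean, smul_apply, sum_apply]
  congr 1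
  induction n with
  | zero => simp
  | succ n ih =>
    rw [Finset.sum_Icc_succ_top (by omega), ih, map_sub,
      ← ContinuousLinearMap.pow_succ_apply']
    abel

/-- The vectors on which the Cesàro means tend to zero. -/
def meanNullSpace (hα : Monotone α) (r s : ℝ) : Submodule ℂ (PowerSeriesSpace α) where
  carrier := {x | ∀ k, Tendsto (fun n => seminorms α k (transposedMean hα r s n x)) atTop (𝓝 0)}
  zero_mem' k := by simp
  add_mem' {x y} hx hy k := by
    have h := (hx k).add (hy k)
    rw [add_zero] at h
    refine squeeze_zero (fun n => apply_nonneg _ _) (fun n => ?_) h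
    rw [map_add]
    exact map_add_le_add _ _ _
  smul_mem' c x hx k := by
    have h := (hx k).const_mul ‖c‖
    rw [mul_zero] at h
    refine h.congr fun n => ?_
    rw [map_smul, map_smul_eq_mul]

/-- After telescoping, `1/n` multiplies a difference that stays bounded by equicontinuity of the
powers. -/
theorem sub_transposed_mem_meanNullSpace (hα : Monotone α) {r s : ℝ}
    (H : ∀ k, ∃ (j : ℕ) (C : ℝ), 0 ≤ C ∧ ∀ (n : ℕ) (x : PowerSeriesSpace α),
      seminorms α k ((transposed hα r s ^ n) x) ≤ C * seminorms α j x)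
    (w : PowerSeriesSpace α) : w - transposed hα r s w ∈ meanNullSpace hα r s := by
  intro k
  obtain ⟨j, C, hC, h⟩ := H k
  have hlim : Tendsto (fun n : ℕ => (n : ℝ)⁻¹ *
      (seminorms α k (transposed hα r s w) + C * seminorms α j w)) atTop (𝓝 0) := by
    simpa using (tendsto_inv_atTop_nhds_zero_nat (𝕜 := ℝ)).mul_const
      (seminorms α k (transposed hα r s w) + C * seminorms α j w)
  refine squeeze_zero (fun n => apply_nonneg _ _) (fun n => ?_) hlim
  rw [transposedMean_sub, map_smul_eq_mul, norm_inv, Complex.norm_natCast]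
  refine mul_le_mul_of_nonneg_left ?_ (by positivity)
  exact (map_sub_le_add _ _ _).trans (by gcongr; exact h _ _)

/-- Each unit sequence lies in the range of `I - A`. If `r = 1`, then `(I - A) e_{m+1} = -s e_m`.
Otherwise `I - A` is triangular with diagonal `1 - r ≠ 0`, and one solves by induction on `m`. -/
theorem unit_mem_meanNullSpace (hα : Monotone α) {r s : ℝ} (hs : s ≠ 0)
    (H : ∀ k, ∃ (j : ℕ) (C : ℝ), 0 ≤ C ∧ ∀ (n : ℕ) (x : PowerSeriesSpace α),
      seminorms α k ((transposed hα r s ^ n) x) ≤ C * seminorms α j x) (m : ℕ) :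
    unit α m ∈ meanNullSpace hα r s := by
  have hs' : (s : ℂ) ≠ 0 := by exact_mod_cast hs
  have hmem := sub_transposed_mem_meanNullSpace hα H
  by_cases hr : r = 1
  · have h := hmem (unit α (m + 1))
    rw [transposed_unit_succ, hr, Complex.ofReal_one, one_smul, sub_add_cancel_left,
      neg_mem_iff] at h
    exact ((meanNullSpace hα r s).smul_mem_iff hs').1 (hr ▸ h)
  · have hr' : (1 - r : ℂ) ≠ 0 := by
      rw [sub_ne_zero]
      exact_mod_cast Ne.symm hr
    induction m with
    | zero =>
      have h := hmem (unit α 0)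
      rw [transposed_unit_zero, show unit α 0 - (r : ℂ) • unit α 0 = (1 - r : ℂ) • unit α 0 by
        rw [sub_smul, one_smul]] at h
      exact ((meanNullSpace hα r s).smul_mem_iff hr').1 h
    | succ m ih =>
      have h := add_mem (hmem (unit α (m + 1))) ((meanNullSpace hα r s).smul_mem (s : ℂ) ih)
      rw [transposed_unit_succ, show unit α (m + 1) - ((r : ℂ) • unit α (m + 1) +
        (s : ℂ) • unit α m) + (s : ℂ) • unit α m = (1 - r : ℂ) • unit α (m + 1) by
          rw [sub_smul, one_smul]; abel] at h
      exact ((meanNullSpace hα r s).smul_mem_iff hr').1 h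

theorem seminorms_transposedMean_le (hα : Monotone α) {r s : ℝ} {j k : ℕ} {C : ℝ} (hC : 0 ≤ C)
    (h : ∀ (n : ℕ) (x : PowerSeriesSpace α),
      seminorms α k ((transposed hα r s ^ n) x) ≤ C * seminorms α j x)
    (n : ℕ) (x : PowerSeriesSpace α) :
    seminorms α k (transposedMean hα r s n x) ≤ C * seminorms α j x := by
  have h0 : 0 ≤ C * seminorms α j x := mul_nonneg hC (apply_nonneg _ _)
  rw [transposedMean, smul_apply, sum_apply, map_smul_eq_mul, norm_inv, Complex.norm_natCast]
  have h1 : seminorms α k (∑ m ∈ Finset.Icc 1 n, (transposed hα r s ^ m) x) ≤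
      n * (C * seminorms α j x) := by
    refine (Finset.le_sum_of_subadditive _ (map_zero _).le
      (map_add_le_add _) _ _).trans ((Finset.sum_le_card_nsmul _ _ _ fun m _ => h m x).trans ?_)
    simp
  refine (mul_le_mul_of_nonneg_left h1 (by positivity)).trans ?_
  rw [← mul_assoc]
  refine mul_le_of_le_one_left h0 ?_
  exact inv_mul_le_one

/-- If the powers of the transposed matrix are equicontinuous, then its Cesàro means tend to zero
uniformly on bounded sets. -/
theorem eventually_seminorms_transposedMean_lt (hα : Monotone α)
    (hα_top : Tendsto α atTop atTop) {r s : ℝ} (hs : s ≠ 0)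
    (H : ∀ k, ∃ (j : ℕ) (C : ℝ), 0 ≤ C ∧ ∀ (n : ℕ) (x : PowerSeriesSpace α),
      seminorms α k ((transposed hα r s ^ n) x) ≤ C * seminorms α j x)
    {S : Set (PowerSeriesSpace α)} (hS : Bornology.IsVonNBounded ℂ S) (k : ℕ) {ε : ℝ}
    (hε : 0 < ε) :
    ∀ᶠ n in atTop, ∀ x ∈ S, seminorms α k (transposedMean hα r s n x) < ε := by
  obtain ⟨j, C, hC, h⟩ := H k
  rw [isVonNBounded_iff] at hS
  -- Index `j + 1` pays for the tail estimate; index `0` bounds the coefficients `|x_m|` of the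
  -- head.
  obtain ⟨M, hM⟩ := hS (j + 1)
  obtain ⟨M₀, hM₀⟩ := hS 0
  have htail : Tendsto (fun N => C * (Real.exp (-α N) * M)) atTop (𝓝 0) := by
    simpa using ((Real.tendsto_exp_neg_atTop_nhds_zero.comp hα_top).mul_const M).const_mul C
  -- `N` is fixed by the tail, uniformly in `n` and in `x ∈ S`; only then is `n` taken large for the
  -- finite head.
  obtain ⟨N, hN⟩ := (htail.eventually_lt_const (half_pos hε)).exists
  have hhead : Tendsto (fun n => ∑ m ∈ Finset.range N,
      M₀ * seminorms α k (transposedMean hα r s n (unit α m))) atTop (𝓝 0) := by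
    simpa using tendsto_finsetSum (Finset.range N) fun m _ =>
      (unit_mem_meanNullSpace hα hs H m k).const_mul M₀
  filter_upwards [hhead.eventually_lt_const (half_pos hε)] with n hn x hx
  have hsplit : x = (∑ m ∈ Finset.range N, toSeq x m • unit α m) +
      (x - ∑ m ∈ Finset.range N, toSeq x m • unit α m) := by abel
  rw [hsplit, map_add]
  refine (map_add_le_add _ _ _).trans_lt ?_
  have h1 : seminorms α k (transposedMean hα r s n (∑ m ∈ Finset.range N, toSeq x m • unit α m)) ≤
      ∑ m ∈ Finset.range N, M₀ * seminorms α k (transposedMean hα r s n (unit α m)) := by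
    rw [map_sum]
    refine (Finset.le_sum_of_subadditive _ (map_zero _).le
      (map_add_le_add _) _ _).trans (Finset.sum_le_sum fun m _ => ?_)
    rw [map_smul, map_smul_eq_mul]
    refine mul_le_mul_of_nonneg_right ?_ (apply_nonneg _ _)
    have := norm_toSeq_mul_le 0 m x
    rw [show expWeight α 0 m = 1 by simp [expWeight], mul_one] at this
    exact this.trans (hM₀ x hx)
  have h2 := seminorms_transposedMean_le hα hC h n
    (x - ∑ m ∈ Finset.range N, toSeq x m • unit α m)
  have h3 : C * seminorms α j (x - ∑ m ∈ Finset.range N, toSeq x m • unit α m) ≤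
      C * (Real.exp (-α N) * M) := by
    refine mul_le_mul_of_nonneg_left ((seminorms_sub_sum_le hα j N x).trans ?_) hC
    exact mul_le_mul_of_nonneg_left (hM x hx) (Real.exp_pos _).le
  linarith

end PowerSeriesSpace

/-! ### Uniform mean ergodicity, eigenvectors and supercyclicity -/

namespace PowerSeriesDual

open PowerSeriesSpace

variable {α : ℕ → ℝ}

theorem isUniformlyMeanErgodic_of_isPowerBounded (hα0 : ∀ n, 0 ≤ α n) (hα : Monotone α)
    (hα_top : Tendsto α atTop atTop) {r s : ℝ} (hs : s ≠ 0)
    (h : IsPowerBounded (diffOp hα r s)) : IsUniformlyMeanErgodic (diffOp hα r s) :=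
  ⟨0, tendstoBounded_zero hα0 (cesaroMean_diffOp_apply hα r s) fun _ hS k _ hε =>
    eventually_seminorms_transposedMean_lt hα hα_top hs
      (exists_bound_of_isPowerBounded hα0 hα h) hS k hε⟩

/-- The coordinate functionals `x ↦ xₙ`. -/
def proj (α : ℕ → ℝ) (n : ℕ) : PowerSeriesDual α where
  toLinearMap := LinearMap.proj n ∘ₗ toSeq
  cont := by
    refine (withSeminorms α).continuous_normedSpace_rng _ _ ⟨{0}, 1, fun x => ?_⟩
    have h := norm_toSeq_mul_le 0 n x
    rw [show expWeight α 0 n = 1 by simp [expWeight], mul_one] at h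
    simpa using h

@[simp] theorem proj_apply (n : ℕ) (x : PowerSeriesSpace α) : proj α n x = toSeq x n := rfl

theorem pow_apply_of_eigenvector (hα : Monotone α) {r s : ℝ} {x : PowerSeriesSpace α} {μ : ℂ}
    (hx : transposed hα r s x = μ • x) (n : ℕ) (φ : PowerSeriesDual α) :
    (diffOp hα r s ^ n) φ x = μ ^ n * φ x := by
  rw [diffOp_pow_apply]
  have : (transposed hα r s ^ n) x = μ ^ n • x := by
    induction n with
    | zero => simp
    | succ n ih =>
      rw [ContinuousLinearMap.pow_succ_apply, ih, map_smul, hx, smul_smul, pow_succ]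
  rw [this, map_smul, smul_eq_mul]

theorem norm_le_one_of_eigenvector (hα : Monotone α) {r s : ℝ} {x : PowerSeriesSpace α} {μ : ℂ}
    (hx : transposed hα r s x = μ • x) {φ : PowerSeriesDual α} (hφ : φ x ≠ 0)
    (h : TendstoStrongly (fun n : ℕ => (n : ℂ)⁻¹ • diffOp hα r s ^ n) 0) : ‖μ‖ ≤ 1 := by
  have h1 := (((continuous_eval_const x).tendsto _).comp (h φ)).norm
  have h2 : Tendsto (fun n : ℕ => ‖μ‖ ^ n / n) atTop (𝓝 0) := by
    have h3 := h1.mul_const ‖φ x‖⁻¹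
    simp only [zero_apply, norm_zero, zero_mul] at h3
    refine h3.congr fun n => ?_
    change ‖(n : ℂ)⁻¹ * (diffOp hα r s ^ n) φ x‖ * _ = _
    have := norm_ne_zero_iff.2 hφ
    rw [pow_apply_of_eigenvector hα hx, norm_mul, norm_mul, norm_pow, norm_inv,
      Complex.norm_natCast]
    field_simp
  by_contra! hμ
  -- If `‖μ‖ > 1`, both `n / ‖μ‖^n` and its reciprocal would tend to zero, yet their product is `1`.
  have h3 := (tendsto_pow_const_div_const_pow_of_one_lt 1 hμ).mul h2
  rw [mul_zero] at h3
  refine one_ne_zero (tendsto_nhds_unique (Tendsto.congr' ?_ h3) tendsto_const_nhds).symm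
  filter_upwards [eventually_ne_atTop 0] with n hn
  have : (n : ℝ) ≠ 0 := by exact_mod_cast hn
  have : ‖μ‖ ^ n ≠ 0 := pow_ne_zero _ (by linarith)
  field_simp

/-- The dual operator is not supercyclic when the original one has two eigenvectors that some
functional separates. -/
theorem not_isSupercyclic_of_eigenvectors (hα : Monotone α) {r s : ℝ} {x y : PowerSeriesSpace α}
    {μ ν : ℂ} (hx : transposed hα r s x = μ • x) (hy : transposed hα r s y = ν • y)
    (hμν : ‖μ‖ ≤ ‖ν‖) {φ : PowerSeriesDual α} (hφx : φ x ≠ 0) (hφy : φ y = 0)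
    {χ : PowerSeriesDual α} (hχ : χ y ≠ 0) : ¬ IsSupercyclic (diffOp hα r s) := by
  rintro ⟨ψ, hψ⟩
  have hcx : Continuous fun θ : PowerSeriesDual α => ‖θ x‖ := (continuous_eval_const x).norm
  have hcy : Continuous fun θ : PowerSeriesDual α => ‖θ y‖ := (continuous_eval_const y).norm
  have horbit : ∀ (n : ℕ) (c : ℂ) (z : PowerSeriesSpace α) (κ : ℂ),
      transposed hα r s z = κ • z →
      ‖(c • (diffOp hα r s ^ n) ψ) z‖ = ‖c‖ * (‖κ‖ ^ n * ‖ψ z‖) := by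
    intro n c z κ hz
    change ‖c * (diffOp hα r s ^ n) ψ z‖ = _
    rw [pow_apply_of_eigenvector hα hz, norm_mul, norm_mul, norm_pow]
  -- If `ψ y = 0`, the whole orbit vanishes at `y`, unlike `χ`. Otherwise it satisfies the closed
  -- condition `|ψ y| |θ x| ≤ |ψ x| |θ y|`, because `‖μ‖ ≤ ‖ν‖`, and `φ` violates this condition.
  by_cases hψy : ψ y = 0
  · obtain ⟨θ, hθ, c, n, rfl⟩ := hψ.inter_open_nonempty {θ | 0 < ‖θ y‖}
      (isOpen_lt continuous_const hcy) ⟨χ, norm_pos_iff.2 hχ⟩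
    rw [Set.mem_ofPred_eq, horbit n c y ν hy, hψy] at hθ
    simp at hθ
  · obtain ⟨θ, hθ, c, n, rfl⟩ := hψ.inter_open_nonempty {θ | ‖ψ x‖ * ‖θ y‖ < ‖ψ y‖ * ‖θ x‖}
      (isOpen_lt (continuous_const.mul hcy) (continuous_const.mul hcx))
      ⟨φ, by
        rw [Set.mem_ofPred_eq, hφy, norm_zero, mul_zero]
        exact mul_pos (norm_pos_iff.2 hψy) (norm_pos_iff.2 hφx)⟩
    rw [Set.mem_ofPred_eq, horbit n c x μ hx, horbit n c y ν hy] at hθ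
    refine hθ.not_ge ?_
    have h1 := pow_le_pow_left₀ (norm_nonneg μ) hμν n
    calc ‖ψ y‖ * (‖c‖ * (‖μ‖ ^ n * ‖ψ x‖)) = (‖ψ y‖ * ‖c‖ * ‖ψ x‖) * ‖μ‖ ^ n := by ring
      _ ≤ (‖ψ y‖ * ‖c‖ * ‖ψ x‖) * ‖ν‖ ^ n := mul_le_mul_of_nonneg_left h1 (by positivity)
      _ = ‖ψ x‖ * (‖c‖ * (‖ν‖ ^ n * ‖ψ y‖)) := by ring

/-- Choosing `ω` so that `s ω` and `r` do not have opposite signs rules out cancellation. This makes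
the eigenvalues at `q = ω ρ` as large as possible. -/
theorem exists_sign_norm_add (r s : ℝ) : ∃ ω : ℝ, |ω| = 1 ∧
    ∀ ρ : ℝ, 0 ≤ ρ → ‖(r : ℂ) + s * ((ω * ρ : ℝ) : ℂ)‖ = |r| + |s| * ρ := by
  have key : ∀ ω ρ : ℝ, ‖(r : ℂ) + s * ((ω * ρ : ℝ) : ℂ)‖ = |r + s * (ω * ρ)| := fun ω ρ => by
    rw [← Complex.ofReal_mul, ← Complex.ofReal_add, Complex.norm_real, Real.norm_eq_abs]
  simp only [key]
  rcases le_or_gt 0 r with h1 | h1 <;> rcases le_or_gt 0 s with h2 | h2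
  · refine ⟨1, by simp, fun ρ hρ => ?_⟩
    rw [abs_of_nonneg h1, abs_of_nonneg h2, abs_of_nonneg (by positivity), one_mul]
  · refine ⟨-1, by simp, fun ρ hρ => ?_⟩
    rw [abs_of_nonneg h1, abs_of_neg h2, abs_of_nonneg (by nlinarith)]
    ring
  · refine ⟨-1, by simp, fun ρ hρ => ?_⟩
    rw [abs_of_neg h1, abs_of_nonneg h2, abs_of_nonpos (by nlinarith)]
    ring
  · refine ⟨1, by simp, fun ρ hρ => ?_⟩
    rw [abs_of_neg h1, abs_of_neg h2, abs_of_nonpos (by nlinarith)]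
    ring

theorem geometric_mem_of_sign (hα_diff : Tendsto (fun n => α (n + 1) - α n) atTop (𝓝 0))
    {ω ρ : ℝ} (hω : |ω| = 1) (hρ0 : 0 < ρ) (hρ1 : ρ < 1) (k : ℕ) :
    (fun n => ((ω * ρ : ℝ) : ℂ) ^ n) ∈ WeightedL2 (expWeight α k) := by
  have h : ‖((ω * ρ : ℝ) : ℂ)‖ = ρ := by
    rw [Complex.norm_real, Real.norm_eq_abs, abs_mul, hω, one_mul, abs_of_pos hρ0]
  exact geometric_mem hα_diff (norm_pos_iff.1 (h.symm ▸ hρ0)) (h.trans_lt hρ1) k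

theorem abs_le_one_of_tendstoStrongly (hα : Monotone α) {r s : ℝ}
    (h : TendstoStrongly (fun n : ℕ => (n : ℂ)⁻¹ • diffOp hα r s ^ n) 0) : |r| ≤ 1 := by
  have h1 := norm_le_one_of_eigenvector hα (transposed_unit_zero hα r s) (φ := proj α 0)
    (by simp [toSeq_unit]) h
  rwa [Complex.norm_real] at h1

/-- The eigenvalues of modulus `|r| + |s| ρ` are at most `1` for every `ρ < 1`, and `ρ → 1` gives
the bound. The endpoint is only a limit: `ρ = 1` gives no sequence in `Λ_∞(α)`. -/
theorem abs_add_abs_le_one_of_tendstoStrongly (hα : Monotone α)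
    (hα_diff : Tendsto (fun n => α (n + 1) - α n) atTop (𝓝 0)) {r s : ℝ}
    (h : TendstoStrongly (fun n : ℕ => (n : ℂ)⁻¹ • diffOp hα r s ^ n) 0) : |r| + |s| ≤ 1 := by
  obtain ⟨ω, hω, hnorm⟩ := exists_sign_norm_add r s
  have hle : ∀ ρ ∈ Set.Ioo (0 : ℝ) 1, |r| + |s| * ρ ≤ 1 := fun ρ hρ => by
    rw [← hnorm ρ hρ.1.le]
    exact norm_le_one_of_eigenvector hα (transposed_geometric hα r s _
      (geometric_mem_of_sign hα_diff hω hρ.1 hρ.2)) (φ := proj α 0) (by simp) h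
  have hlim : Tendsto (fun ρ : ℝ => |r| + |s| * ρ) (𝓝[<] 1) (𝓝 (|r| + |s| * 1)) :=
    (Continuous.tendsto (by fun_prop) 1).mono_left nhdsWithin_le_nhds
  rw [mul_one] at hlim
  refine le_of_tendsto hlim ?_
  filter_upwards [Ioo_mem_nhdsLT (zero_lt_one' ℝ)] with ρ hρ using hle ρ hρ

theorem not_isSupercyclic_diffOp (hα : Monotone α)
    (hα_diff : Tendsto (fun n => α (n + 1) - α n) atTop (𝓝 0)) (r s : ℝ) :
    ¬ IsSupercyclic (diffOp hα r s) := by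
  obtain ⟨ω, hω, hnorm⟩ := exists_sign_norm_add r s
  have hx := transposed_geometric hα r s _
    (geometric_mem_of_sign hα_diff hω (ρ := 1 / 4) (by norm_num) (by norm_num))
  have hy := transposed_geometric hα r s _
    (geometric_mem_of_sign hα_diff hω (ρ := 1 / 2) (by norm_num) (by norm_num))
  have hω0 : (ω : ℂ) ≠ 0 := by
    rintro h0
    simp [Complex.ofReal_eq_zero.1 h0] at hω
  refine not_isSupercyclic_of_eigenvectors hα hx hy ?_
    -- On `(q^n)` this `φ` takes the value `q - ω/2`: zero at the eigenvector with `q = ω/2`, and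
    -- `-ω/4` at the one with `q = ω/4`.
    (φ := proj α 1 - ((ω * (1 / 2) : ℝ) : ℂ) • proj α 0) ?_ ?_ (χ := proj α 0) (by simp)
  · rw [hnorm _ (by norm_num), hnorm _ (by norm_num)]
    nlinarith [abs_nonneg s]
  · change ((ω * (1 / 4) : ℝ) : ℂ) ^ 1 -
      ((ω * (1 / 2) : ℝ) : ℂ) * ((ω * (1 / 4) : ℝ) : ℂ) ^ 0 ≠ 0
    rw [show ((ω * (1 / 4) : ℝ) : ℂ) ^ 1 -
      ((ω * (1 / 2) : ℝ) : ℂ) * ((ω * (1 / 4) : ℝ) : ℂ) ^ 0 = -(ω / 4) by push_cast; ring]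
    exact neg_ne_zero.2 (div_ne_zero hω0 (by norm_num))
  · simp [sub_apply, smul_apply]

end PowerSeriesDual

end

theorem proposition4p13 (α : ℕ → ℝ) (hα0 : ∀ n, 0 ≤ α n) (hα : Monotone α)
    (hα_top : Tendsto α atTop atTop) (l : ℝ) (hl : 0 ≤ l)
    (hα_diff : Tendsto (fun n => α (n + 1) - α n) atTop (𝓝 l))
    (r s : ℝ) (hr : r ≠ 0) (hs : s ≠ 0) :
    -- equivalence in the case `l = 0`
    (l = 0 → List.TFAE [
      IsPowerBounded (diffOp hα r s),
      IsUniformlyMeanErgodic (diffOp hα r s),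
      IsMeanErgodic (diffOp hα r s),
      TendstoStrongly (fun n : ℕ => (n : ℂ)⁻¹ • diffOp hα r s ^ n) 0,
      |r| + |s| ≤ 1]) ∧
    -- chain of implications in the case `l > 0`
    (0 < l →
      (IsPowerBounded (diffOp hα r s) → IsUniformlyMeanErgodic (diffOp hα r s)) ∧
      (IsUniformlyMeanErgodic (diffOp hα r s) → IsMeanErgodic (diffOp hα r s)) ∧
      (IsMeanErgodic (diffOp hα r s) →
        TendstoStrongly (fun n : ℕ => (n : ℂ)⁻¹ • diffOp hα r s ^ n) 0) ∧
      (TendstoStrongly (fun n : ℕ => (n : ℂ)⁻¹ • diffOp hα r s ^ n) 0 → |r| ≤ 1)) ∧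
    -- convergence to zero uniformly on bounded sets
    (|r| + |s| < 1 → TendstoBounded (fun n : ℕ => diffOp hα r s ^ n) 0) ∧
    -- failure of supercyclicity
    (l = 0 → ¬ IsSupercyclic (diffOp hα r s)) := by
  refine ⟨fun h0 => ?_, fun _ => ⟨?_, ?_, ?_, ?_⟩, ?_, fun h0 => ?_⟩
  · subst h0
    tfae_have 1 → 2 :=
      PowerSeriesDual.isUniformlyMeanErgodic_of_isPowerBounded hα0 hα hα_top hs
    tfae_have 2 → 3 := IsUniformlyMeanErgodic.isMeanErgodic
    tfae_have 3 → 4 := IsMeanErgodic.tendstoStrongly_inv_smul_pow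
    tfae_have 4 → 5 := PowerSeriesDual.abs_add_abs_le_one_of_tendstoStrongly hα hα_diff
    tfae_have 5 → 1 := PowerSeriesDual.isPowerBounded_diffOp hα
    tfae_finish
  · exact PowerSeriesDual.isUniformlyMeanErgodic_of_isPowerBounded hα0 hα hα_top hs
  · exact IsUniformlyMeanErgodic.isMeanErgodic
  · exact IsMeanErgodic.tendstoStrongly_inv_smul_pow
  · exact PowerSeriesDual.abs_le_one_of_tendstoStrongly hα
  · exact PowerSeriesDual.tendstoBounded_diffOp_pow hα0 hα
  · subst h0
    exact PowerSeriesDual.not_isSupercyclic_diffOp hα hα_diff r s
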